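/- Let $G$ be a Polish group acting on a standard Borel space $X$ by a Borel action $G\times X\to X$, and let $d:X\times X\to[0,\infty]$ be a metric (the value $\infty$ is allowed) that is analytic, i.e. $\{(x,y)\in X^2: d(x,y)<r\}$ is an analytic set for every $r>0$, and for which $G$ acts by isometries. Suppose that $d$ is complete and that the topology induced by $d$ refines some Polish topology on $X$ which generates the Borel structure of $X$ and for which the action of $G$ is continuous. Put $$\rho_{G,d}(x,y)=\inf\{d(gx,hy): g,h\in G\},\qquad x,y\in X$$ (such a $\rho_{G,d}$ is called a CTR orbit pseudometric), and let $E_{\rho_{G,d}}=\{(x,y)\in X^2:\rho_{G,d}(x,y)=0\}$. Let $E_1$ be the equivalence relation on $(2^{\mathbb N})^{\mathbb N}$ given by $x\,E_1\,y\iff\exists N\ \forall n\ge N:\ x(n)=y(n)$. Then $E_1$ is not Borel reducible to $E_{\rho_{G,d}}$: there is no Borel map $f:(2^{\mathbb N})^{\mathbb N}\to X$ such that $x\,E_1\,y\iff f(x)\,E_{\rho_{G,d}}\,f(y)$ for all $x,y$. -/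

import Mathlib

open Set Filter Topology
open scoped ENNReal

/-- A subset of a standard Borel space is analytic if it is analytic for some (equivalently, for
every) Polish topology that generates the Borel structure. -/
def IsAnalyticIn {α : Type*} [MeasurableSpace α] (s : Set α) : Prop :=
  ∃ _τ : TopologicalSpace α, PolishSpace α ∧ BorelSpace α ∧ MeasureTheory.AnalyticSet s

/-- A pseudometric on a set, possibly attaining the value `∞`. -/
structure IsPseudometric {X : Type*} (d : X → X → ℝ≥0∞) : Prop where
  self : ∀ x, d x x = 0
  symm : ∀ x y, d x y = d y x
  triangle : ∀ x y z, d x z ≤ d x y + d y z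

/-- A pseudometric on a standard Borel space is analytic if all the sets `{(x, y) | d x y < r}`,
`r > 0`, are analytic. -/
structure IsAnalyticPseudometric {X : Type*} [MeasurableSpace X] (d : X → X → ℝ≥0∞) : Prop
    extends IsPseudometric d where
  analytic : ∀ r : ℝ, 0 < r → IsAnalyticIn {p : X × X | d p.1 p.2 < ENNReal.ofReal r}

/-- Sequential completeness of `X` with respect to `d`. -/
def IsCompleteFor {X : Type*} (d : X → X → ℝ≥0∞) : Prop :=
  ∀ u : ℕ → X, (∀ ε : ℝ≥0∞, 0 < ε → ∃ N, ∀ m ≥ N, ∀ n ≥ N, d (u m) (u n) < ε) →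
    ∃ x, Tendsto (fun n => d (u n) x) atTop (𝓝 0)

/-- The topology induced by `d` refines the topology `τ`: every `τ`-open set is `d`-open. -/
def Refines {X : Type*} (d : X → X → ℝ≥0∞) (τ : TopologicalSpace X) : Prop :=
  ∀ U : Set X, IsOpen[τ] U → ∀ x ∈ U, ∃ ε : ℝ≥0∞, 0 < ε ∧ ∀ y, d x y < ε → y ∈ U

/-- `ρ_{G,d}(x, y) = inf {d(gx, hy) : g, h ∈ G}`. -/
noncomputable def orbitDist (G : Type*) {X : Type*} [Group G] [MulAction G X]
    (d : X → X → ℝ≥0∞) (x y : X) : ℝ≥0∞ :=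
  ⨅ (g : G) (h : G), d (g • x) (h • y)

/-- The data defining an orbit pseudometric: the action of the Polish group `G` on the standard
Borel space `X` is Borel, and it is by isometries of the analytic pseudometric `d`. -/
structure IsOrbitData (G : Type*) {X : Type*} [Group G] [TopologicalSpace G]
    [MeasurableSpace X] [MulAction G X] (d : X → X → ℝ≥0∞) : Prop where
  borel_action : letI : MeasurableSpace G := borel G
    Measurable (fun p : G × X => p.1 • p.2)
  analytic : IsAnalyticPseudometric d
  isometric : ∀ (g : G) (x y : X), d (g • x) (g • y) = d x y

/-- `G`, `X`, `d` make `ρ_{G,d}` a CTR orbit pseudometric: `d` is a complete metric, refining some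
Polish topology that generates the Borel structure of `X` and makes the action continuous. -/
structure IsCTR (G : Type*) {X : Type*} [Group G] [TopologicalSpace G]
    [MeasurableSpace X] [MulAction G X] (d : X → X → ℝ≥0∞) : Prop
    extends IsOrbitData G d where
  eq_of_dist_eq_zero : ∀ x y, d x y = 0 → x = y
  complete : IsCompleteFor d
  refines : ∃ τ : TopologicalSpace X, PolishSpace X ∧ BorelSpace X ∧ ContinuousSMul G X ∧
    Refines d τ

/-- The relation `E_ρ`: being at distance zero. -/
def zeroRel {X : Type*} (ρ : X → X → ℝ≥0∞) (x y : X) : Prop := ρ x y = 0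

/-- The relation `E₁` on `(2^ℕ)^ℕ` of eventual equality. -/
def E₁ (x y : ℕ → (ℕ → Bool)) : Prop := ∃ N, ∀ n ≥ N, x n = y n

/-- `E ≤_B F`: there is a Borel map `f` with `x E y ↔ f x F f y`. -/
def BorelReducible {X Y : Type*} [MeasurableSpace X] [MeasurableSpace Y]
    (E : X → X → Prop) (F : Y → Y → Prop) : Prop :=
  ∃ f : X → Y, Measurable f ∧ ∀ x y, E x y ↔ F (f x) (f y)

/-! A reduction `θ` would be `ρ`-constant under changes of one coordinate; the claim is that `ρ`
then also identifies two sequences differing in every coordinate, contradicting `E₁`. By a category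
argument (`eventually_exists_isOpen_moveSet`), for generic `x` a small generic change of one
coordinate moves `θ x`, up to any prescribed error, by a group element arbitrarily close to `1`.
Changing coordinate `n` at stage `n` yields `x n → y` and `h n → l` in `G` such that `(h n)⁻¹ • θ (x
n)` is `d`-Cauchy. Completeness gives a `d`-limit. As `d` refines the topology, the action is
continuous, and `θ` is continuous on a residual set containing all `x n` and `y`, this limit is `l⁻¹
• θ y`. Hence `ρ (θ (x 0)) (θ y) = 0`. -/

/-! ### Baire category and analytic sets. -/

section BaireCategory

variable {α β : Type*} [TopologicalSpace α] [TopologicalSpace β]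

/-- The points in every neighbourhood of which `s` is nonmeagre. -/
def nonmeagrePoints (s : Set α) : Set α :=
  {x | ∀ U, IsOpen U → x ∈ U → ¬ IsMeagre (s ∩ U)}

theorem isClosed_nonmeagrePoints (s : Set α) : IsClosed (nonmeagrePoints s) := by
  rw [← isOpen_compl_iff, isOpen_iff_mem_nhds]
  intro x hx
  simp only [nonmeagrePoints, mem_compl_iff, mem_ofPred_eq, not_forall, not_not] at hx
  obtain ⟨U, hU, hxU, hm⟩ := hx
  filter_upwards [hU.mem_nhds hxU] with y hy h
  exact h U hU hy hm

theorem nonmeagrePoints_subset_closure (s : Set α) : nonmeagrePoints s ⊆ closure s := by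
  intro x hx
  rw [mem_closure_iff]
  intro U hU hxU
  rw [inter_comm]
  exact nonempty_of_not_isMeagre (hx U hU hxU)

theorem isMeagre_diff_nonmeagrePoints [SecondCountableTopology α] (s : Set α) :
    IsMeagre (s \ nonmeagrePoints s) := by
  have hb := TopologicalSpace.isBasis_countableBasis α
  refine IsMeagre.mono (s := ⋃ U ∈ {U ∈ TopologicalSpace.countableBasis α | IsMeagre (s ∩ U)},
    s ∩ U) ?_ (isMeagre_biUnion
      ((TopologicalSpace.countable_countableBasis α).mono (sep_subset _ _)) fun U hU => hU.2)
  rintro x ⟨hxs, hx⟩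
  simp only [nonmeagrePoints, mem_ofPred_eq, not_forall, not_not] at hx
  obtain ⟨U, hU, hxU, hm⟩ := hx
  obtain ⟨V, hV, hxV, hVU⟩ := hb.exists_subset_of_mem_open hxU hU
  exact mem_biUnion (show V ∈ {U ∈ TopologicalSpace.countableBasis α | IsMeagre (s ∩ U)} from
    ⟨hV, hm.mono (inter_subset_inter_right _ hVU)⟩) ⟨hxs, hxV⟩

theorem IsClosed.isMeagre_diff_interior {s : Set α} (hs : IsClosed s) :
    IsMeagre (s \ interior s) := by
  rw [← hs.frontier_eq]
  exact IsNowhereDense.isMeagre (by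
    rw [isClosed_frontier.isNowhereDense_iff]; exact interior_frontier hs)

theorem IsOpen.isMeagre_closure_diff {s : Set α} (hs : IsOpen s) : IsMeagre (closure s \ s) := by
  rw [← hs.frontier_eq]
  exact IsNowhereDense.isMeagre (by
    rw [isClosed_frontier.isNowhereDense_iff]; exact frontier_compl s ▸ interior_frontier hs.isClosed_compl)

/-- Off the open set `O` every `s i` is meagre, so the left-hand set lies in `closure O`, and an
open set has meagre boundary. -/
theorem isMeagre_nonmeagrePoints_iUnion_diff [SecondCountableTopology α] {ι : Type*} [Countable ι]
    (s : ι → Set α) :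
    IsMeagre (nonmeagrePoints (⋃ i, s i) \ ⋃ i, nonmeagrePoints (s i)) := by
  set O : Set α := ⋃ i, interior (nonmeagrePoints (s i)) with hO
  have hOo : IsOpen O := isOpen_iUnion fun i => isOpen_interior
  refine hOo.isMeagre_closure_diff.mono ?_
  rintro x ⟨hx, hxn⟩
  refine ⟨?_, fun h => hxn (iUnion_mono (fun i => interior_subset) h)⟩
  by_contra hc
  refine hx (closure O)ᶜ isClosed_closure.isOpen_compl hc ?_
  refine (isMeagre_iUnion fun i => (isMeagre_diff_nonmeagrePoints (s i)).union
    (isClosed_nonmeagrePoints (s i)).isMeagre_diff_interior).mono ?_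
  rintro y ⟨hy, hyO⟩
  obtain ⟨i, hi⟩ := mem_iUnion.1 hy
  refine mem_iUnion.2 ⟨i, ?_⟩
  by_cases h : y ∈ nonmeagrePoints (s i)
  · exact Or.inr ⟨h, fun h' => hyO (subset_closure (mem_iUnion.2 ⟨i, h'⟩))⟩
  · exact Or.inl ⟨hi, h⟩

/-- Analytic sets have the Baire property. -/
theorem MeasureTheory.AnalyticSet.baireMeasurableSet [SecondCountableTopology α] [T2Space α]
    {s : Set α} (hs : MeasureTheory.AnalyticSet s) : BaireMeasurableSet s := by
  rw [MeasureTheory.AnalyticSet] at hs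
  rcases hs with rfl | ⟨f, hf, rfl⟩
  · exact isOpen_empty.baireMeasurableSet
  let A : List ℕ → Set α := fun l => f '' {z | (List.range l.length).map z = l}
  have hA0 : A [] = range f := by simp [A]
  have hAU : ∀ l, A l = ⋃ n, A (l ++ [n]) := by
    intro l
    simp only [A, ← image_iUnion]
    congr 1
    ext z
    simp [List.range_succ]
  -- Outside the meagre set `M`, a finite branch `l` with `x ∈ nonmeagrePoints (A l)` always extends
  -- by one digit; the infinite branch `z` so obtained satisfies `f z = x`.
  let M : Set α := ⋃ l, nonmeagrePoints (A l) \ ⋃ n, nonmeagrePoints (A (l ++ [n]))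
  have hM : IsMeagre M := isMeagre_iUnion fun l => by
    have := isMeagre_nonmeagrePoints_iUnion_diff fun n => A (l ++ [n])
    rwa [← hAU] at this
  have key : ∀ x ∈ nonmeagrePoints (range f), x ∉ M → x ∈ range f := by
    intro x hx hxM
    have step : ∀ l : {l // x ∈ nonmeagrePoints (A l)},
        ∃ n, x ∈ nonmeagrePoints (A (l.1 ++ [n])) := by
      intro l
      by_contra h
      exact hxM (mem_iUnion.2 ⟨l.1, l.2, by simpa using h⟩)
    choose next hnext using step
    let σ : ℕ → {l // x ∈ nonmeagrePoints (A l)} := fun k =>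
      Nat.rec ⟨[], by rwa [hA0]⟩ (fun _ l => ⟨l.1 ++ [next l], hnext l⟩) k
    let z : ℕ → ℕ := fun k => next (σ k)
    have hσ : ∀ k, (σ k).1 = (List.range k).map z := by
      intro k
      induction k with
      | zero => rfl
      | succ k ih =>
        rw [List.range_succ, List.map_append, ← ih]
        rfl
    refine ⟨z, ?_⟩
    by_contra hne
    obtain ⟨U, V, hU, hV, hzU, hxV, hUV⟩ := t2_separation hne
    obtain ⟨k, hk⟩ : ∃ k, PiNat.cylinder z k ⊆ f ⁻¹' U := by
      obtain ⟨v, ⟨y, k, rfl⟩, hz, hv⟩ := (PiNat.isTopologicalBasis_cylinders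
        (fun _ : ℕ => ℕ)).exists_subset_of_mem_open (mem_preimage.2 hzU) (hU.preimage hf)
      exact ⟨k, by rwa [PiNat.mem_cylinder_iff_eq.1 hz]⟩
    have hx' := nonmeagrePoints_subset_closure _ (σ k).2
    obtain ⟨_, hw, y, hy, rfl⟩ := mem_closure_iff.1 hx' V hV hxV
    refine disjoint_left.1 hUV (hk ?_) hw
    rw [PiNat.mem_cylinder_iff]
    intro i hi
    have hy' : (List.range k).map y = (List.range k).map z := by
      have : (σ k).1.length = k := by simp [hσ]
      rw [mem_ofPred_eq, this, hσ] at hy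
      exact hy
    exact List.map_inj_left.1 hy' i (List.mem_range.2 hi)
  refine (isClosed_nonmeagrePoints (range f)).isOpen_compl.baireMeasurableSet.of_compl.congr ?_
  rw [eventuallyEq_set]
  filter_upwards [hM, isMeagre_diff_nonmeagrePoints (range f)] with x h1 h2
  exact ⟨fun h => key x h h1, fun h => by_contra fun h' => h2 ⟨h, h'⟩⟩

/-- The easy half of the Kuratowski–Ulam theorem. -/
theorem eventually_residual_curry [SecondCountableTopology β] {p : α × β → Prop}
    (hp : ∀ᵇ q, p q) : ∀ᵇ a : α, ∀ᵇ b : β, p (a, b) := by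
  obtain ⟨S, hSo, hSd, hSc, hS⟩ := mem_residual_iff.1 hp
  have main : ∀ T ∈ S, ∀ᵇ a : α, ∀ᵇ b : β, (a, b) ∈ T := by
    intro T hT
    have hb := TopologicalSpace.isBasis_countableBasis β
    have h : ∀ W ∈ TopologicalSpace.countableBasis β, ∀ᵇ a : α, ∃ b ∈ W, (a, b) ∈ T := by
      intro W hW
      have hWne := TopologicalSpace.nonempty_of_mem_countableBasis hW
      have hWo := TopologicalSpace.isOpen_of_mem_countableBasis hW
      have he : {a : α | ∃ b ∈ W, (a, b) ∈ T} = Prod.fst '' (univ ×ˢ W ∩ T) := by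
        ext a; simp
      refine residual_of_dense_open ?_ ?_
      · rw [he]
        exact isOpenMap_fst _ ((isOpen_univ.prod hWo).inter (hSo T hT))
      · rw [he, dense_iff_inter_open]
        intro U hU hUne
        obtain ⟨q, hq, hqT⟩ := (hSd T hT).inter_open_nonempty _ (hU.prod hWo) (hUne.prod hWne)
        exact ⟨q.1, hq.1, q, ⟨⟨trivial, hq.2⟩, hqT⟩, rfl⟩
    have := (eventually_countable_ball (TopologicalSpace.countable_countableBasis β)).2 h
    filter_upwards [this] with a ha
    refine residual_of_dense_open ((hSo T hT).preimage (by fun_prop)) ?_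
    rw [hb.dense_iff]
    intro W hW _
    obtain ⟨b, hbW, hbT⟩ := ha W hW
    exact ⟨b, hbW, hbT⟩
  filter_upwards [(eventually_countable_ball hSc).2 main] with a ha
  filter_upwards [(eventually_countable_ball hSc).2 ha] with b hb
  exact hS hb

/-- A Borel map to a second countable space is continuous on a residual set. -/
theorem Measurable.exists_residual_continuousOn [MeasurableSpace α] [BorelSpace α]
    [SecondCountableTopology β] [MeasurableSpace β] [OpensMeasurableSpace β] {f : α → β}
    (hf : Measurable f) : ∃ C ∈ residual α, ContinuousOn f C := by
  have hb := TopologicalSpace.isBasis_countableBasis β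
  have h : ∀ W ∈ TopologicalSpace.countableBasis β, ∃ O : Set α, IsOpen O ∧ f ⁻¹' W =ᵇ O :=
    fun W hW => (hf (TopologicalSpace.isOpen_of_mem_countableBasis
      hW).measurableSet).residualEq_isOpen
  choose! O hO hfO using h
  refine ⟨{x | ∀ W ∈ TopologicalSpace.countableBasis β, x ∈ f ⁻¹' W ↔ x ∈ O W},
    (eventually_countable_ball (TopologicalSpace.countable_countableBasis β)).2
      fun W hW => eventuallyEq_set.1 (hfO W hW), ?_⟩
  intro x hx
  refine hb.nhds_hasBasis.tendsto_right_iff.2 fun W hW => ?_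
  filter_upwards [mem_nhdsWithin_of_mem_nhds ((hO W hW.1).mem_nhds ((hx W hW.1).1 hW.2)),
    self_mem_nhdsWithin] with y hy hyC
  exact (hyC W hW.1).2 hy

end BaireCategory

/-- The projection of a Borel part of the Borel preimage of an analytic set is analytic. -/
theorem MeasureTheory.AnalyticSet.fst_image_inter_preimage {Z T Q : Type*} [TopologicalSpace Z]
    [PolishSpace Z] [MeasurableSpace Z] [BorelSpace Z] [TopologicalSpace T] [PolishSpace T]
    [MeasurableSpace T] [BorelSpace T] [TopologicalSpace Q] [PolishSpace Q] [MeasurableSpace Q]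
    [BorelSpace Q] {S : Set Q} (hS : AnalyticSet S) {Φ : Z × T → Q} (hΦ : Measurable Φ)
    {B : Set (Z × T)} (hB : MeasurableSet B) : AnalyticSet (Prod.fst '' (B ∩ Φ ⁻¹' S)) := by
  rw [AnalyticSet] at hS
  rcases hS with rfl | ⟨F, hF, rfl⟩
  · simpa using analyticSet_empty
  -- A parameter `y` with `F y = Φ q` witnesses membership in `S`, turning the set into a projection
  -- of a Borel set.
  have hm : MeasurableSet {q : (Z × T) × (ℕ → ℕ) | q.1 ∈ B ∧ Φ q.1 = F q.2} :=
    (measurable_fst hB).inter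
      (measurableSet_eq_fun (hΦ.comp measurable_fst) (hF.measurable.comp measurable_snd))
  convert hm.analyticSet.image_of_continuous (f := fun q => q.1.1) (by fun_prop) using 1
  ext z
  simp only [mem_image, mem_inter_iff, mem_preimage, mem_range, mem_ofPred_eq, Prod.exists]
  constructor
  · rintro ⟨z', t, ⟨hB, y, hy⟩, rfl⟩
    exact ⟨z', t, y, ⟨hB, hy.symm⟩, rfl⟩
  · rintro ⟨z', t, y, ⟨hB, hy⟩, rfl⟩
    exact ⟨z', t, ⟨hB, y, hy.symm⟩, rfl⟩

/-! ### Generic changes of one coordinate. -/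

section CoordinateUpdate

variable {K : Type*} [TopologicalSpace K]

theorem continuous_uncurry_update (n : ℕ) :
    Continuous fun q : (ℕ → K) × K => Function.update q.1 n q.2 :=
  continuous_fst.update n continuous_snd

theorem isOpenMap_uncurry_update (n : ℕ) :
    IsOpenMap fun q : (ℕ → K) × K => Function.update q.1 n q.2 := by
  refine IsOpenMap.of_sections fun q => ⟨fun y => (Function.update y n (q.1 n), y n), ?_, ?_, ?_⟩
  · exact ((continuous_id.update n continuous_const).prodMk (continuous_apply n)).continuousAt
  · simp
  · intro y
    simp

/-- Every residual set of sequences contains a residual set that is stable under generic changes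
of one coordinate. -/
theorem exists_residual_subset_update_stable [SecondCountableTopology K] {S : Set (ℕ → K)}
    (hS : S ∈ residual (ℕ → K)) : ∃ D ∈ residual (ℕ → K), D ⊆ S ∧
      ∀ x ∈ D, ∀ n, ∀ᵇ u : K, Function.update x n u ∈ D := by
  -- Generic updates of a point of `F^[k+1] S` stay in `F^[k] S`, so the intersection of all
  -- iterates is stable.
  let F : Set (ℕ → K) → Set (ℕ → K) :=
    fun D => {x | x ∈ D ∧ ∀ n, ∀ᵇ u : K, Function.update x n u ∈ D}
  have hF : ∀ D ∈ residual (ℕ → K), F D ∈ residual (ℕ → K) := by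
    intro D hD
    refine inter_mem hD (eventually_countable_forall.2 fun n => ?_)
    exact eventually_residual_curry (tendsto_residual_of_isOpenMap
      (continuous_uncurry_update n) (isOpenMap_uncurry_update n) hD)
  have hk : ∀ k, F^[k] S ∈ residual (ℕ → K) := by
    intro k
    induction k with
    | zero => exact hS
    | succ k ih => rw [Function.iterate_succ_apply']; exact hF _ ih
  refine ⟨⋂ k, F^[k] S, countable_iInter_mem.2 hk, iInter_subset _ 0, fun x hx n => ?_⟩
  simp only [mem_iInter]
  refine eventually_countable_forall.2 fun k => ?_
  have := mem_iInter.1 hx (k + 1)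
  rw [Function.iterate_succ_apply'] at this
  exact this.2 n

end CoordinateUpdate

/-! ### Small coordinate changes are realised by small group elements. -/

/-- The pairs `(x, u)` for which replacing the `n`-th coordinate of `x` by `u` moves `θ x`, up to
`ε`, by an element of `V`. -/
def moveSet {G X K : Type*} [SMul G X] (d : X → X → ℝ≥0∞) (θ : (ℕ → K) → X) (n : ℕ) (V : Set G)
    (ε : ℝ) : Set ((ℕ → K) × K) :=
  {q | ∃ g ∈ V, d (g • θ q.1) (θ (Function.update q.1 n q.2)) < ENNReal.ofReal ε}

section MoveSet

variable {G X K : Type*} [Group G] [TopologicalSpace G] [MulAction G X] {d : X → X → ℝ≥0∞}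
  {θ : (ℕ → K) → X}

theorem baireMeasurableSet_moveSet [PolishSpace G] [TopologicalSpace X] [PolishSpace X]
    [MeasurableSpace X] [BorelSpace X] [ContinuousSMul G X] [TopologicalSpace K] [PolishSpace K]
    [MeasurableSpace K] [BorelSpace K] (hd : IsAnalyticPseudometric d) (hθ : Measurable θ) (n : ℕ)
    {V : Set G} (hV : IsOpen V) {ε : ℝ} (hε : 0 < ε) :
    BaireMeasurableSet (moveSet d θ n V ε) := by
  borelize G
  obtain ⟨τ, hp, hb, hS⟩ := hd.analytic ε hε
  have hΦ : Measurable fun q : ((ℕ → K) × K) × G =>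
      (q.2 • θ q.1.1, θ (Function.update q.1.1 n q.1.2)) := by
    refine Measurable.prodMk ?_ (hθ.comp ((continuous_uncurry_update n).measurable.comp
      measurable_fst))
    exact (continuous_smul (M := G) (X := X)).measurable.comp
      (measurable_snd.prodMk (hθ.comp (measurable_fst.comp measurable_fst)))
  have h := @MeasureTheory.AnalyticSet.fst_image_inter_preimage ((ℕ → K) × K) G (X × X) _ _ _ _ _ _
    _ _ τ hp _ hb _ hS _ hΦ (univ ×ˢ V) (MeasurableSet.univ.prod hV.measurableSet)
  convert h.baireMeasurableSet using 1
  ext q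
  simp [moveSet]

/-- Countably many `W g` with `W g * (W g)⁻¹ ⊆ V` cover `G`, so some `moveSet` for `W g` is generic
on an open set. If `a, b ∈ W g` move `θ x` to its updates by `u` and `v` up to `ε / 2`, then `b *
a⁻¹ ∈ V` moves one update to the other up to `ε`. -/
theorem eventually_exists_isOpen_moveSet [IsTopologicalGroup G] [SecondCountableTopology G]
    [TopologicalSpace K] [PolishSpace K] (hd : IsPseudometric d)
    (hiso : ∀ (g : G) x y, d (g • x) (g • y) = d x y) {n : ℕ}
    (hbm : ∀ V : Set G, IsOpen V → ∀ ε : ℝ, 0 < ε → BaireMeasurableSet (moveSet d θ n V ε))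
    (hθ : ∀ q, ∀ ε : ℝ, 0 < ε → q ∈ moveSet d θ n (univ : Set G) ε)
    {V : Set G} (hV : IsOpen V) (h1V : 1 ∈ V) {ε : ℝ} (hε : 0 < ε) :
    ∀ᵇ x : ℕ → K, ∃ U : Set K, IsOpen U ∧ x n ∈ U ∧ ∀ᵇ u : K, u ∈ U → (x, u) ∈ moveSet d θ n V ε := by
  have hW : ∀ g : G, ∃ W : Set G, IsOpen W ∧ g ∈ W ∧ ∀ a ∈ W, ∀ b ∈ W, b * a⁻¹ ∈ V := by
    intro g
    have hc : Continuous fun p : G × G => p.2 * p.1⁻¹ := by fun_prop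
    obtain ⟨W₁, W₂, h1, h2, hg1, hg2, h⟩ := isOpen_prod_iff.1 (hV.preimage hc) g g (by simpa)
    exact ⟨W₁ ∩ W₂, h1.inter h2, ⟨hg1, hg2⟩, fun a ha b hb => h (mk_mem_prod ha.1 hb.2)⟩
  choose W hWo hgW hWV using hW
  obtain ⟨s, hsc, hs⟩ :=
    TopologicalSpace.countable_cover_nhds fun g => (hWo g).mem_nhds (hgW g)
  choose O' hO'o hO' using fun g => (hbm (W g) (hWo g) (ε / 2) (half_pos hε)).residualEq_isOpen
  obtain ⟨O, hOo, hO⟩ := (hbm V hV ε hε).residualEq_isOpen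
  let f : (ℕ → K) × K → (ℕ → K) := fun q => Function.update q.1 n q.2
  have hfc : Continuous f := continuous_uncurry_update n
  have hfo : IsOpenMap f := isOpenMap_uncurry_update n
  let Θ : ((ℕ → K) × K) × K → (ℕ → K) × K := Prod.map f id
  have hΘc : Continuous Θ := hfc.prodMap continuous_id
  have hΘo : IsOpenMap Θ := hfo.prodMap IsOpenMap.id
  -- `O` is only determined up to a meagre set and may miss the points `(x, x n)`; the interior of
  -- its closure differs from it by a meagre set and captures them for a dense set of `x`.
  let Q : Set (ℕ → K) := {x | (x, x n) ∈ interior (closure O)}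
  have hQo : IsOpen Q := isOpen_interior.preimage (by fun_prop)
  have hQd : Dense Q := by
    rw [dense_iff_inter_open]
    rintro N hN ⟨y, hy⟩
    obtain ⟨q, hqN, hq⟩ := (dense_of_mem_residual ((eventually_countable_ball hsc).2 fun g _ =>
      eventuallyEq_set.1 (hO' g))).inter_open_nonempty _ (hN.preimage hfc)
        ⟨(y, y n), by simpa [f] using hy⟩
    obtain ⟨g, hgs, hqg⟩ : ∃ g ∈ s, q ∈ moveSet d θ n (W g) (ε / 2) := by
      obtain ⟨a, -, ha⟩ := hθ q (ε / 2) (half_pos hε)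
      obtain ⟨g, hg, hag⟩ := mem_iUnion₂.1 (hs.symm ▸ mem_univ a : a ∈ ⋃ x ∈ s, W x)
      exact ⟨g, hg, a, hag, ha⟩
    have hqO := (hq g hgs).1 hqg
    let T : Set (((ℕ → K) × K) × K) := {t | t.1 ∈ O' g ∧ (t.1.1, t.2) ∈ O' g}
    have hT : IsOpen T := ((hO'o g).preimage (by fun_prop)).inter ((hO'o g).preimage (by fun_prop))
    have hTO : ∀ᵇ t, t ∈ T → Θ t ∈ O := by
      have e1 := (tendsto_residual_of_isOpenMap (α := ((ℕ → K) × K) × K) continuous_fst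
        isOpenMap_fst).eventually (eventuallyEq_set.1 (hO' g))
      have e2 := (tendsto_residual_of_isOpenMap (α := ((ℕ → K) × K) × K)
        (continuous_fst.prodMap continuous_id)
        (isOpenMap_fst.prodMap IsOpenMap.id)).eventually (eventuallyEq_set.1 (hO' g))
      have e3 := (tendsto_residual_of_isOpenMap hΘc hΘo).eventually (eventuallyEq_set.1 hO)
      filter_upwards [e1, e2, e3] with ⟨⟨x, u⟩, v⟩ h1 h2 h3 ht
      obtain ⟨a, ha, hau⟩ := h1.2 ht.1
      obtain ⟨b, hb, hbv⟩ := h2.2 ht.2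
      refine h3.1 ⟨b * a⁻¹, hWV g a ha b hb, ?_⟩
      simp only [Prod.map, id, Function.update_idem, Θ, f] at hau hbv ⊢
      calc d ((b * a⁻¹) • θ (Function.update x n u)) (θ (Function.update x n v))
          ≤ d ((b * a⁻¹) • θ (Function.update x n u)) ((b * a⁻¹) • a • θ x)
            + d (b • θ x) (θ (Function.update x n v)) := by
            convert hd.triangle _ ((b * a⁻¹) • a • θ x) _ using 3
            simp [mul_smul]
        _ < ENNReal.ofReal (ε / 2) + ENNReal.ofReal (ε / 2) := by
            rw [hiso, hd.symm]
            exact ENNReal.add_lt_add hau hbv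
        _ = ENNReal.ofReal ε := by
            rw [← ENNReal.ofReal_add (half_pos hε).le (half_pos hε).le, add_halves]
    have hTc : Θ '' T ⊆ closure O := by
      rintro _ ⟨t, ht, rfl⟩
      refine map_mem_closure hΘc
        ((dense_of_mem_residual hTO).open_subset_closure_inter hT ht) fun r hr => hr.2 hr.1
    refine ⟨f q, hqN, ?_⟩
    -- Taking `v = u` lands on the diagonal point `(f q, f q n)`.
    have := interior_maximal hTc (hΘo _ hT) (mem_image_of_mem Θ (show (q, q.2) ∈ T from ⟨hqO, hqO⟩))
    simpa [Q, Θ, f] using this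
  have hA : ∀ᵇ q, q ∈ interior (closure O) → q ∈ moveSet d θ n V ε := by
    filter_upwards [eventuallyEq_set.1 hO,
      eventuallyEq_set.1 (closure_residualEq hOo.isLocallyClosed)] with q h1 h2 h3
    exact h1.2 (h2.1 (interior_subset h3))
  filter_upwards [residual_of_dense_open hQo hQd, eventually_residual_curry hA] with x hx hx'
  exact ⟨{u | (x, u) ∈ interior (closure O)}, isOpen_interior.preimage (by fun_prop), hx, hx'⟩

end MoveSet

/-! ### The orbit pseudometric. -/

section OrbitDist

variable {G X : Type*} [Group G] [MulAction G X] {d : X → X → ℝ≥0∞}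

theorem IsCompleteFor.exists_tendsto_of_le_geometric (hd : IsPseudometric d)
    (hc : IsCompleteFor d) {u : ℕ → X} (hu : ∀ n, d (u n) (u (n + 1)) ≤ 1 / 2 ^ n) :
    ∃ x, Tendsto (fun n => d (u n) x) atTop (𝓝 0) := by
  let _ : PseudoEMetricSpace X :=
    { edist := d, edist_self := hd.self, edist_comm := hd.symm, edist_triangle := hd.triangle }
  have h : CauchySeq u := cauchySeq_of_edist_le_geometric_two 1 ENNReal.one_ne_top hu
  exact hc u (EMetric.cauchySeq_iff.1 h)

theorem orbitDist_le (x y : X) (g h : G) : orbitDist G d x y ≤ d (g • x) (h • y) :=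
  (iInf_le _ g).trans (iInf_le _ h)

theorem exists_dist_lt_of_orbitDist_lt (hiso : ∀ (g : G) x y, d (g • x) (g • y) = d x y) {x y : X}
    {ε : ℝ≥0∞} (h : orbitDist G d x y < ε) : ∃ g : G, d (g • x) y < ε := by
  simp only [orbitDist, iInf_lt_iff] at h
  obtain ⟨g, k, h⟩ := h
  refine ⟨k⁻¹ * g, ?_⟩
  rwa [← hiso k, mul_smul, smul_inv_smul]

theorem orbitDist_triangle (hd : IsPseudometric d)
    (hiso : ∀ (g : G) x y, d (g • x) (g • y) = d x y) (x y z : X) :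
    orbitDist G d x z ≤ orbitDist G d x y + orbitDist G d y z := by
  refine ENNReal.le_of_forall_pos_le_add fun ε hε hlt => ?_
  have hε' : (ε : ℝ≥0∞) / 2 ≠ 0 := by simpa using hε.ne'
  rw [ENNReal.add_lt_top] at hlt
  obtain ⟨g, hg⟩ := exists_dist_lt_of_orbitDist_lt hiso (ENNReal.lt_add_right hlt.1.ne hε')
  obtain ⟨h, hh⟩ := exists_dist_lt_of_orbitDist_lt hiso (ENNReal.lt_add_right hlt.2.ne hε')
  calc orbitDist G d x z ≤ d ((h * g) • x) ((1 : G) • z) := orbitDist_le _ _ _ _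
    _ ≤ d ((h * g) • x) (h • y) + d (h • y) ((1 : G) • z) := hd.triangle _ _ _
    _ ≤ (orbitDist G d x y + ε / 2) + (orbitDist G d y z + ε / 2) := by
        rw [mul_smul, hiso, one_smul]
        exact add_le_add hg.le hh.le
    _ = orbitDist G d x y + orbitDist G d y z + (ε / 2 + ε / 2) := by ring
    _ = _ := by rw [ENNReal.add_halves]

end OrbitDist

theorem Refines.tendsto {X : Type*} {d : X → X → ℝ≥0∞} (hd : IsPseudometric d)
    [τ : TopologicalSpace X] (h : Refines d τ) {u : ℕ → X} {x : X}
    (hu : Tendsto (fun n => d (u n) x) atTop (𝓝 0)) : Tendsto u atTop (𝓝 x) := by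
  rw [tendsto_nhds]
  intro U hU hx
  obtain ⟨ε, hε, hU⟩ := h U hU x hx
  filter_upwards [hu.eventually_lt_const hε] with n hn
  exact hU _ (hd.symm x _ ▸ hn)

/-! ### The inductive construction and the theorem. -/

/-- A Borel map that identifies, in the sense of `orbitDist`, sequences differing in one coordinate,
also identifies two sequences that differ in every coordinate. -/
theorem exists_forall_ne_orbitDist_eq_zero {G X K : Type*} [Group G] [TopologicalSpace G]
    [IsTopologicalGroup G] [PolishSpace G] [MulAction G X] [TopologicalSpace X] [PolishSpace X]
    [MeasurableSpace X] [BorelSpace X] [ContinuousSMul G X] [TopologicalSpace K] [PolishSpace K]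
    [MeasurableSpace K] [BorelSpace K] [Nonempty K] [PerfectSpace K] {d : X → X → ℝ≥0∞}
    (hd : IsAnalyticPseudometric d) (hiso : ∀ (g : G) x y, d (g • x) (g • y) = d x y)
    (hc : IsCompleteFor d) (href : Refines d ‹TopologicalSpace X›) {θ : (ℕ → K) → X}
    (hθ : Measurable θ)
    (hE : ∀ x n u, orbitDist G d (θ x) (θ (Function.update x n u)) = 0) :
    ∃ x y : ℕ → K, (∀ n, y n ≠ x n) ∧ orbitDist G d (θ x) (θ y) = 0 := by
  let _ := TopologicalSpace.upgradeIsCompletelyMetrizable G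
  have hd' := hd.toIsPseudometric
  obtain ⟨C₀, hC₀, hθC₀⟩ := hθ.exists_residual_continuousOn
  obtain ⟨C, hCC₀, hCδ, hCd⟩ := mem_residual.1 hC₀
  have hC := residual_of_dense_Gδ hCδ hCd
  obtain ⟨O, hO, hCO⟩ := hCδ.eq_iInter_nat
  obtain ⟨V, hV, hVb⟩ := (nhds_basis_opens (1 : G)).exists_antitone_subbasis
  have hloc : ∀ᵇ x : ℕ → K, ∀ n k m : ℕ, ∃ U : Set K, IsOpen U ∧ x n ∈ U ∧
      ∀ᵇ u : K, u ∈ U → (x, u) ∈ moveSet d θ n (V k) (1 / 2 ^ m) := by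
    simp only [eventually_countable_forall]
    intro n k m
    refine eventually_exists_isOpen_moveSet hd' hiso
      (fun V hV ε hε => baireMeasurableSet_moveSet hd hθ n hV hε) (fun q ε hε => ?_)
      (hV k).2 (hV k).1 (by positivity)
    obtain ⟨g, hg⟩ := exists_dist_lt_of_orbitDist_lt hiso
      ((hE q.1 n q.2).trans_lt (ENNReal.ofReal_pos.2 hε))
    exact ⟨g, mem_univ _, hg⟩
  obtain ⟨D, hD, hDsub, hDupd⟩ := exists_residual_subset_update_stable (inter_mem hC hloc)
  obtain ⟨x₀, hx₀⟩ := (dense_of_mem_residual hD).nonempty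
  -- The current sequence, the accumulated group element, and a neighbourhood confining all later
  -- sequences.
  let State := {s : (ℕ → K) × G × Set (ℕ → K) // s.1 ∈ D ∧ IsOpen s.2.2 ∧ s.1 ∈ s.2.2}
  have step : ∀ (n : ℕ) (s : State), ∃ t : State,
      (∃ u, u ≠ s.1.1 n ∧ t.1.1 = Function.update s.1.1 n u) ∧
      dist s.1.2.1 t.1.2.1 ≤ 1 * (1 / 2 : ℝ) ^ n ∧
      d (s.1.2.1⁻¹ • θ s.1.1) (t.1.2.1⁻¹ • θ t.1.1) ≤ 1 / 2 ^ n ∧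
      t.1.2.2 ⊆ s.1.2.2 ∧ closure t.1.2.2 ⊆ O n := by
    rintro n ⟨⟨x, h, N⟩, hx, hN, hxN⟩
    -- The metric on `G` need not be right-invariant, so `k` depends on the current `h`.
    obtain ⟨k, hk⟩ : ∃ k, V k ⊆ {g | dist h (g * h) < (1 / 2 : ℝ) ^ n} := by
      have : {g | dist h (g * h) < (1 / 2 : ℝ) ^ n} ∈ 𝓝 (1 : G) :=
        (isOpen_lt (by fun_prop) continuous_const).mem_nhds (by simp)
      obtain ⟨k, -, hk⟩ := hVb.toHasBasis.mem_iff.1 this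
      exact ⟨k, hk⟩
    obtain ⟨U, hU, hxU, hUm⟩ := (hDsub hx).2 n k n
    have hUN : IsOpen (U ∩ {u | Function.update x n u ∈ N} ∩ {x n}ᶜ) :=
      (hU.inter (hN.preimage (continuous_const.update n continuous_id))).inter
        isOpen_compl_singleton
    have hne : (U ∩ {u | Function.update x n u ∈ N} ∩ {x n}ᶜ).Nonempty :=
      (dense_compl_singleton (x n)).inter_open_nonempty _
        (hU.inter (hN.preimage (continuous_const.update n continuous_id)))
        ⟨x n, hxU, by simpa using hxN⟩
    obtain ⟨u, ⟨⟨huU, huN⟩, hux⟩, hum, huD⟩ :=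
      (dense_of_mem_residual (hUm.and (hDupd x hx n))).inter_open_nonempty _ hUN hne
    obtain ⟨g, hg, hgd⟩ := hum huU
    have huO : Function.update x n u ∈ N ∩ O n :=
      ⟨huN, mem_iInter.1 (hCO ▸ (hDsub huD).1) n⟩
    obtain ⟨F, ⟨hF, hFc⟩, hFN⟩ := (closed_nhds_basis _).mem_iff.1
      ((hN.inter (hO n)).mem_nhds huO)
    refine ⟨⟨⟨Function.update x n u, g * h, interior F⟩, huD, isOpen_interior,
      mem_interior_iff_mem_nhds.2 hF⟩, ⟨u, hux, rfl⟩, ?_, ?_, ?_, ?_⟩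
    · rw [one_mul]
      exact le_of_lt (hk hg)
    · rw [← hiso (g * h)]
      simp only [mul_smul, smul_inv_smul, mul_inv_rev]
      refine hgd.le.trans_eq ?_
      rw [ENNReal.ofReal_div_of_pos (by positivity), ENNReal.ofReal_pow (by norm_num)]
      simp
    · exact interior_subset.trans (hFN.trans inter_subset_left)
    · exact (closure_minimal interior_subset hFc).trans (hFN.trans inter_subset_right)
  choose next hupd hdist hdd hsub hcl using step
  let s : ℕ → State := fun n =>
    Nat.rec ⟨⟨x₀, 1, univ⟩, hx₀, isOpen_univ, mem_univ _⟩ (fun n t => next n t) n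
  have hs : ∀ n, s (n + 1) = next n (s n) := fun n => rfl
  let x : ℕ → ℕ → K := fun n => (s n).1.1
  let h : ℕ → G := fun n => (s n).1.2.1
  have hxupd : ∀ n, ∃ u, u ≠ x n n ∧ x (n + 1) = Function.update (x n) n u :=
    fun n => hupd n (s n)
  have hxne : ∀ n i, i ≠ n → x (n + 1) i = x n i := by
    intro n i hi
    obtain ⟨u, -, h⟩ := hxupd n
    rw [h, Function.update_of_ne hi]
  have hx_before : ∀ n i, n ≤ i → x n i = x 0 i := by
    intro n
    induction n with
    | zero => intro i _; rfl
    | succ n ih => intro i hi; rw [hxne n i (by omega), ih i (by omega)]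
  have hx_after : ∀ i n, i + 1 ≤ n → x n i = x (i + 1) i := by
    intro i n hn
    induction n, hn using Nat.le_induction with
    | base => rfl
    | succ n hn ih => rw [hxne n i (by omega), ih]
  let y : ℕ → K := fun i => x (i + 1) i
  have hyx : ∀ i, y i ≠ x 0 i := by
    intro i
    obtain ⟨u, hu, h⟩ := hxupd i
    rw [← hx_before i i le_rfl]
    simpa [y, h] using hu
  have hxy : Tendsto x atTop (𝓝 y) := by
    rw [tendsto_pi_nhds]
    intro i
    refine tendsto_const_nhds.congr' ?_
    filter_upwards [eventually_ge_atTop (i + 1)] with n hn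
    exact (hx_after i n hn).symm
  have hyC : y ∈ C := by
    rw [hCO, mem_iInter]
    -- All later terms stay in a set whose closure lies in `O n`, so the limit does too.
    intro n
    refine hcl n (s n) (mem_closure_of_tendsto hxy ?_)
    filter_upwards [eventually_ge_atTop (n + 1)] with m hm
    have hmono : Antitone fun n => (s n).1.2.2 := antitone_nat_of_succ_le fun n => hsub n (s n)
    exact hmono hm (s m).2.2.2
  have hθy : Tendsto (fun n => θ (x n)) atTop (𝓝 (θ y)) :=
    (hθC₀ y (hCC₀ hyC)).tendsto.comp (tendsto_nhdsWithin_iff.2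
      ⟨hxy, Eventually.of_forall fun n => hCC₀ (hDsub (s n).2.1).1⟩)
  obtain ⟨l, hl⟩ := cauchySeq_tendsto_of_complete
    (cauchySeq_of_le_geometric (1 / 2) 1 (by norm_num) fun n => hdist n (s n) : CauchySeq h)
  obtain ⟨z, hz⟩ := hc.exists_tendsto_of_le_geometric (u := fun n => (h n)⁻¹ • θ (x n)) hd'
    fun n => hdd n (s n)
  have hzl : z = l⁻¹ • θ y :=
    tendsto_nhds_unique (href.tendsto hd' hz) (hl.inv.smul hθy)
  have hzero : ∀ n, orbitDist G d (θ (x 0)) (θ (x n)) = 0 := by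
    intro n
    induction n with
    | zero => exact le_antisymm ((orbitDist_le _ _ 1 1).trans_eq (hd'.self _)) bot_le
    | succ n ih =>
      obtain ⟨u, -, h⟩ := hxupd n
      refine le_antisymm ((orbitDist_triangle hd' hiso _ (θ (x n)) _).trans ?_) bot_le
      rw [ih, h, hE, add_zero]
  refine ⟨x 0, y, hyx, le_antisymm (ge_of_tendsto' hz fun n => ?_) bot_le⟩
  calc orbitDist G d (θ (x 0)) (θ y)
      ≤ orbitDist G d (θ (x 0)) (θ (x n)) + orbitDist G d (θ (x n)) (θ y) :=
        orbitDist_triangle hd' hiso _ _ _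
    _ ≤ d ((h n)⁻¹ • θ (x n)) z := by
        rw [hzero, zero_add, hzl]
        exact orbitDist_le _ _ _ _

theorem perfectSpace_cantor : PerfectSpace (ℕ → Bool) := by
  refine ⟨preperfect_iff_nhds.2 fun x _ U hU => ?_⟩
  have ht : Tendsto (fun n => Function.update x n (!x n)) atTop (𝓝 x) := by
    rw [tendsto_pi_nhds]
    intro i
    refine tendsto_const_nhds.congr' ?_
    filter_upwards [eventually_gt_atTop i] with n hn
    rw [Function.update_of_ne hn.ne]
  obtain ⟨n, hn⟩ := (ht.eventually hU).exists
  refine ⟨_, ⟨hn, mem_univ _⟩, fun h => ?_⟩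
  simpa using congrFun h n

theorem theorem2p9 {G X : Type*} [Group G] [TopologicalSpace G] [IsTopologicalGroup G]
    [PolishSpace G] [MeasurableSpace X] [StandardBorelSpace X] [MulAction G X]
    (d : X → X → ℝ≥0∞) (hd : IsCTR G d) :
    ¬ BorelReducible E₁ (zeroRel (orbitDist G d)) := by
  rintro ⟨θ, hθ, hE⟩
  obtain ⟨τ, hp, hb, hs, href⟩ := hd.refines
  have := perfectSpace_cantor
  have : TopologicalSpace.IsCompletelyMetrizableSpace (ℕ → Bool) := inferInstance
  have : PolishSpace (ℕ → Bool) := inferInstance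
  obtain ⟨x, y, hne, h0⟩ := exists_forall_ne_orbitDist_eq_zero hd.analytic hd.isometric hd.complete
    href hθ fun x n u => (hE x _).1 ⟨n + 1, fun m hm => by
      rw [Function.update_of_ne (by omega)]⟩
  obtain ⟨N, hN⟩ := (hE x y).2 h0
  exact hne N (hN N le_rfl).symm
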